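/- Let $\Gamma$ be a rectifiable Jordan curve, positively oriented, or more generally a positively oriented system of finitely many pairwise disjoint rectifiable Jordan curves, meaning that its total winding number about every point off $\Gamma$ is $0$ or $1$. Let $\Omega$ be the open region enclosed by $\Gamma$, i.e. the set of points off $\Gamma$ about which the winding number of $\Gamma$ is $1$. Let $E\subset\Omega$ be compact (for instance, a compact set whose boundary is piecewise smooth and consists of finitely many disjoint rectifiable Jordan curves). Let $f$ be analytic in $\Omega$ and continuous on $\Omega\cup\Gamma$. Let $0\le m\le n$ be integers, let $x_0,\dots,x_n\in\Omega$ be distinct, and let $z_1,\dots,z_m\in\mathbb{C}$ be distinct and different from all $x_i$. Put $$\phi(x)=\phi_{n+1,m}(x)=\prod_{i=0}^n(x-x_i)\Big/\prod_{j=1}^m(x-z_j).$$ A rational interpolant of $f$ of type $(n,m)$ with these nodes and prescribed poles is a function of the form $r(x)=p(x)/\prod_{j=1}^m(x-z_j)$, with $p$ a polynomial of degree at most $n$, such that $r(x_i)=f(x_i)$ for $i=0,\dots,n$. Then: 1. For every $C\neq0$, the barycentric formula $$r_{n,m}(x)=\sum_{i=0}^n\frac{w_i f(x_i)}{x-x_i}\Big/\sum_{i=0}^n\frac{w_i}{x-x_i},\qquad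 w_i=C\,\frac{\prod_{j=1}^m(x_i-z_j)}{\prod_{l\ne i}(x_i-x_l)},$$ with $r_{n,m}(x_i)=f(x_i)$ at the nodes, defines such a rational interpolant. 2. For every such rational interpolant $r_{n,m}$ and every $x\in E\setminus\{z_1,\dots,z_m\}$ (hence every $x\in E$ if no $z_j$ lies in $E$), $$f(x)-r_{n,m}(x)=\frac1{2\pi i}\int_\Gamma\frac{\phi_{n+1,m}(x)}{\phi_{n+1,m}(t)}\,\frac{f(t)}{t-x}\,dt .$$ (If some $z_j$ lies on $\Gamma$, the factor $1/\phi_{n+1,m}(t)$ is understood as $0$ at $t=z_j$.) -/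

import Mathlib

open scoped NNReal

noncomputable section

namespace HermiteRational

/-- A rectifiable Jordan curve in the plane: a simple closed curve given by a Lipschitz
parametrization on `[0, 1]` (for a curve of finite length, e.g. the one proportional to
arc length). -/
structure RectifiableJordanCurve where
  toFun : ℝ → ℂ
  lipschitz : ∃ K : ℝ≥0, LipschitzOnWith K toFun (Set.Icc 0 1)
  closed : toFun 0 = toFun 1
  simple : Set.InjOn toFun (Set.Ico 0 1)

/-- The set of points of the curve. -/
def RectifiableJordanCurve.trace (γ : RectifiableJordanCurve) : Set ℂ :=
  γ.toFun '' Set.Icc 0 1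

/-- The integral `∫_γ g(t) dt`. A Lipschitz parametrization is differentiable almost everywhere. -/
def RectifiableJordanCurve.integral (γ : RectifiableJordanCurve) (g : ℂ → ℂ) : ℂ :=
  ∫ s in (0 : ℝ)..1, g (γ.toFun s) * deriv γ.toFun s

variable {k : ℕ}

/-- The set of points of a finite system of curves. -/
def traceOf (Γ : Fin k → RectifiableJordanCurve) : Set ℂ := ⋃ a, (Γ a).trace

/-- The integral `∫_Γ g(t) dt` over a finite system of curves. -/
def integralOver (Γ : Fin k → RectifiableJordanCurve) (g : ℂ → ℂ) : ℂ :=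
  ∑ a, (Γ a).integral g

/-- The winding number of a system of curves about a point off the curves. -/
def windingNumber (Γ : Fin k → RectifiableJordanCurve) (z : ℂ) : ℂ :=
  (2 * Real.pi * Complex.I)⁻¹ * integralOver Γ (fun t => (t - z)⁻¹)

/-- A positively oriented Jordan system: pairwise disjoint Jordan curves whose total winding
number about each point off the curves is `0` or `1`. For a single curve this says that it
is positively oriented. -/
structure IsPositiveJordanSystem (Γ : Fin k → RectifiableJordanCurve) : Prop where
  disjoint : Pairwise fun a b => Disjoint (Γ a).trace (Γ b).trace
  winding : ∀ z, z ∉ traceOf Γ → windingNumber Γ z = 0 ∨ windingNumber Γ z = 1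

/-- The open region enclosed by a positively oriented Jordan system. -/
def inside (Γ : Fin k → RectifiableJordanCurve) : Set ℂ :=
  {z | z ∉ traceOf Γ ∧ windingNumber Γ z = 1}

variable {n m : ℕ}

/-- `φ(ζ) = ∏ (ζ - x_i) / ∏ (ζ - z_j)`. -/
def phi (x : Fin (n + 1) → ℂ) (z : Fin m → ℂ) (ζ : ℂ) : ℂ :=
  (∏ i, (ζ - x i)) / ∏ j, (ζ - z j)

/-- `r` is a rational function of type `(n, m)` with denominator `∏ (ζ - z_j)` that
interpolates `f` at the nodes `x_i`. Nothing is said about the value of `r` at a `z_j`. -/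
structure IsRationalInterpolant (x : Fin (n + 1) → ℂ) (z : Fin m → ℂ) (f r : ℂ → ℂ) : Prop where
  rational : ∃ p : Polynomial ℂ, p.natDegree ≤ n ∧
    ∀ ζ : ℂ, (∀ j, ζ ≠ z j) → r ζ = p.eval ζ / ∏ j, (ζ - z j)
  interpolates : ∀ i, r (x i) = f (x i)

/-- The barycentric weight `w_i = C ∏_j (x_i - z_j) / ∏_{l ≠ i} (x_i - x_l)`. -/
def baryWeight (C : ℂ) (x : Fin (n + 1) → ℂ) (z : Fin m → ℂ) (i : Fin (n + 1)) : ℂ :=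
  C * (∏ j, (x i - z j)) / ∏ l ∈ Finset.univ.erase i, (x i - x l)

open Classical in
/-- The barycentric rational function `(∑ w_i f(x_i) / (ζ - x_i)) / (∑ w_i / (ζ - x_i))`,
with its limiting value `f(x_i)` at the nodes. -/
def baryRational (C : ℂ) (x : Fin (n + 1) → ℂ) (z : Fin m → ℂ) (f : ℂ → ℂ) (ζ : ℂ) : ℂ :=
  if ∃ i, ζ = x i then f ζ
  else (∑ i, baryWeight C x z i * f (x i) / (ζ - x i)) / ∑ i, baryWeight C x z i / (ζ - x i)

end HermiteRational

end

/-! Write `ℓ(t) = ∏ (t - x_i)` and `q(t) = ∏ (t - z_j)`. Both claims rest on the partial fractions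
`p/ℓ = ∑ λ_i p(x_i)/(t - x_i)`, valid for `deg p ≤ n` (`eval_div_prod_sub_eq_sum`). Applied to `q`
and to the interpolant of `q f`, they turn the barycentric quotient into `p/q`. For the error,
expand `q/ℓ` under the integral, split each `1/((t - x_i)(t - ξ))` into simple fractions and apply
Cauchy's formula at `ξ` and at the nodes; the values recombine to `φ(ξ) (q f - p)(ξ)/ℓ(ξ) = f(ξ) -
r(ξ)`.

The analytic work is Cauchy's theorem for `f` merely continuous up to rectifiable curves.
Integrating the Cauchy–Pompeiu formula along `Γ` and exchanging integrals gives `∫_Γ φ = 2i ∫_inside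
∂φ/∂z̄` for compactly supported `C¹` functions: the inner integral is a winding number, so no
topology beyond the values `0` and `1` is needed. Now extend `f` continuously and mollify at scale
`ε`. Inside, the mollification is holomorphic farther than `ε` from `Γ`. Nearer, its `∂/∂z̄` is at
most a constant times `ω(ε)/ε`, with `ω` the modulus of continuity, on a set of area `O(ε)`. Hence
the integral over `Γ` is `O(ω(ε))` and vanishes in the limit. -/

namespace HermiteRational

section

open MeasureTheory Set Filter Topology Complex
open scoped Convolution

/-! ### Wirtinger derivative and the Cauchy–Pompeiu formula -/

/-- The Wirtinger derivative `∂φ/∂z̄`. -/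
noncomputable def dbar (φ : ℂ → ℂ) (w : ℂ) : ℂ :=
  (fderiv ℝ φ w 1 + I * fderiv ℝ φ w I) / 2

lemma dbar_eq_zero {φ : ℂ → ℂ} {w : ℂ} (h : DifferentiableAt ℂ φ w) : dbar φ w = 0 := by
  have h1 : fderiv ℝ φ w I = I * fderiv ℝ φ w 1 := by
    rw [h.fderiv_restrictScalars ℝ]
    simp
  rw [dbar, h1, ← mul_assoc, I_mul_I]
  ring

lemma norm_dbar_le (φ : ℂ → ℂ) (w : ℂ) : ‖dbar φ w‖ ≤ ‖fderiv ℝ φ w‖ := by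
  have h1 := (fderiv ℝ φ w).le_opNorm 1
  have h2 := (fderiv ℝ φ w).le_opNorm I
  rw [norm_one, mul_one] at h1
  rw [norm_I, mul_one] at h2
  rw [dbar, norm_div, RCLike.norm_ofNat]
  have h3 := norm_add_le (fderiv ℝ φ w 1) (I * fderiv ℝ φ w I)
  rw [norm_mul, norm_I, one_mul] at h3
  linarith

lemma continuous_dbar {φ : ℂ → ℂ} (h : ContDiff ℝ 1 φ) : Continuous (dbar φ) := by
  have := h.continuous_fderiv one_ne_zero
  unfold dbar
  fun_prop

lemma hasCompactSupport_dbar {φ : ℂ → ℂ} (h : HasCompactSupport φ) :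
    HasCompactSupport (dbar φ) := by
  refine (h.fderiv ℝ).mono fun w hw => ?_
  contrapose! hw
  simp only [Function.mem_support, not_not] at hw ⊢
  simp [dbar, hw]

/-- In polar coordinates, `∂φ/∂z̄` is `e^{iθ} / 2` times the sum of the radial derivative and
`i` times the normalized angular derivative. -/
lemma dbar_mul_inv_polar (φ : ℂ → ℂ) {r : ℝ} (hr : 0 < r) (θ : ℝ) :
    r • (dbar φ (r * exp (θ * I)) * (r * exp (θ * I))⁻¹) =
      (fderiv ℝ φ (r * exp (θ * I)) (exp (θ * I)) +
        I * fderiv ℝ φ (r * exp (θ * I)) (I * exp (θ * I))) / 2 := by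
  rw [dbar]
  generalize fderiv ℝ φ (r * exp (θ * I)) = D
  -- `D` is only real-linear, so it is determined by its values at `1` and `I`.
  have hD (v : ℂ) : D v = v.re * D 1 + v.im * D I := by
    conv_lhs => rw [← re_add_im v]
    have h1 : (v.re : ℂ) = v.re • (1 : ℂ) := by simp
    have h2 : (v.im : ℂ) * I = v.im • I := by simp
    rw [map_add, h1, h2, map_smul, map_smul]
    simp
  have hr' : (r : ℂ) ≠ 0 := by exact_mod_cast hr.ne'
  have e1 : exp (θ * I) = Real.cos θ + Real.sin θ * I := by simp [exp_mul_I]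
  have e2 : exp (-(θ * I)) = Real.cos θ - Real.sin θ * I := by
    rw [← neg_mul, exp_mul_I]; simp [sub_eq_add_neg]
  have e3 : (exp (θ * I)).re = Real.cos θ := exp_ofReal_mul_I_re θ
  have e4 : (exp (θ * I)).im = Real.sin θ := exp_ofReal_mul_I_im θ
  rw [hD (exp (θ * I)), hD (I * exp (θ * I)), real_smul, mul_inv, ← exp_neg, e2, I_mul_re,
    I_mul_im, e3, e4, mul_left_comm, mul_inv_cancel_left₀ hr']
  push_cast
  linear_combination (-(Complex.sin θ : ℂ) * D I / 2) * I_sq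

lemma integrableOn_polarCoord_target_of_continuous {f : ℝ × ℝ → ℂ} (hf : Continuous f) {R : ℝ}
    (hR : ∀ p : ℝ × ℝ, R < p.1 → f p = 0) : IntegrableOn f polarCoord.target := by
  have h1 : IntegrableOn f (Icc 0 R ×ˢ Icc (-Real.pi) Real.pi) :=
    hf.continuousOn.integrableOn_compact (isCompact_Icc.prod isCompact_Icc)
  refine h1.of_forall_sdiff_eq_zero polarCoord.open_target.measurableSet ?_
  rintro ⟨r, θ⟩ ⟨⟨hr, hθ⟩, h⟩
  apply hR
  by_contra! hlt
  exact h ⟨⟨le_of_lt hr, hlt⟩, ⟨hθ.1.le, hθ.2.le⟩⟩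

lemma hasDerivAt_radial {φ : ℂ → ℂ} (hφ : ContDiff ℝ 1 φ) (r θ : ℝ) :
    HasDerivAt (fun s : ℝ => φ (s * exp (θ * I)))
      (fderiv ℝ φ (r * exp (θ * I)) (exp (θ * I))) r := by
  have h := (hφ.differentiable one_ne_zero (r * exp (θ * I))).hasFDerivAt
  refine h.comp_hasDerivAt r ?_
  simpa using (hasDerivAt_id r).ofReal_comp.mul_const (exp (θ * I))

lemma hasDerivAt_angular {φ : ℂ → ℂ} (hφ : ContDiff ℝ 1 φ) (r θ : ℝ) :
    HasDerivAt (fun s : ℝ => φ (r * exp (s * I)))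
      (r * fderiv ℝ φ (r * exp (θ * I)) (I * exp (θ * I))) θ := by
  have h := (hφ.differentiable one_ne_zero (r * exp (θ * I))).hasFDerivAt
  have h2 : HasDerivAt (fun s : ℝ => (r : ℂ) * exp (s * I)) (r • (I * exp (θ * I))) θ := by
    have := (((hasDerivAt_id θ).ofReal_comp.mul_const I).cexp).const_mul (r : ℂ)
    simpa [mul_comm] using this
  have h3 := h.comp_hasDerivAt θ h2
  rwa [map_smul, real_smul] at h3

/-- In polar coordinates the Jacobian `r` cancels the singularity of `w⁻¹`. The radial term
integrates to `-φ 0` along every ray, and the angular term to zero around every circle. -/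
lemma integral_dbar_mul_inv {φ : ℂ → ℂ} (hφ : ContDiff ℝ 1 φ) (hc : HasCompactSupport φ) :
    ∫ w, dbar φ w * w⁻¹ = -(Real.pi * φ 0) := by
  have hcont := hφ.continuous_fderiv one_ne_zero
  obtain ⟨R, hR⟩ := hc.isCompact.isBounded.exists_norm_le
  have hnorm (r θ : ℝ) : ‖(r : ℂ) * exp (θ * I)‖ = |r| := by
    rw [norm_mul, norm_exp_ofReal_mul_I, mul_one, norm_real, Real.norm_eq_abs]
  have hzero (r θ : ℝ) (h : R < r) : (r : ℂ) * exp (θ * I) ∉ tsupport φ := by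
    intro h'
    have := hR _ h'
    rw [hnorm] at this
    linarith [le_abs_self r]
  have hfz (r θ : ℝ) (h : R < r) : fderiv ℝ φ (r * exp (θ * I)) = 0 := by
    by_contra h'
    exact hzero r θ h (support_fderiv_subset ℝ h')
  have hA : Continuous fun p : ℝ × ℝ => fderiv ℝ φ (p.1 * exp (p.2 * I)) (exp (p.2 * I)) := by
    fun_prop
  have hB : Continuous fun p : ℝ × ℝ => fderiv ℝ φ (p.1 * exp (p.2 * I)) (I * exp (p.2 * I)) := by
    fun_prop
  have hAi := integrableOn_polarCoord_target_of_continuous hA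
    (R := R) fun p hp => by simp [hfz p.1 p.2 hp]
  have hBi := integrableOn_polarCoord_target_of_continuous hB
    (R := R) fun p hp => by simp [hfz p.1 p.2 hp]
  have key : ∫ w, dbar φ w * w⁻¹ = ∫ p in polarCoord.target,
      (fderiv ℝ φ (p.1 * exp (p.2 * I)) (exp (p.2 * I)) +
        I * fderiv ℝ φ (p.1 * exp (p.2 * I)) (I * exp (p.2 * I))) / 2 := by
    rw [← Complex.integral_comp_polarCoord_symm]
    refine setIntegral_congr_fun polarCoord.open_target.measurableSet fun p hp => ?_
    have e : Complex.polarCoord.symm p = p.1 * exp (p.2 * I) := by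
      rw [Complex.polarCoord_symm_apply, exp_mul_I]; simp
    simp only [e]
    exact dbar_mul_inv_polar φ hp.1 p.2
  have hAint : ∫ p in polarCoord.target,
      fderiv ℝ φ (p.1 * exp (p.2 * I)) (exp (p.2 * I)) = -(2 * Real.pi * φ 0) := by
    change ∫ p in Ioi (0 : ℝ) ×ˢ Ioo (-Real.pi) Real.pi, _ ∂(volume.prod volume) = _
    rw [← Measure.prod_restrict, ← integral_prod_swap]
    rw [integral_prod]
    · have (θ : ℝ) : ∫ r in Ioi (0 : ℝ), fderiv ℝ φ (r * exp (θ * I)) (exp (θ * I)) = -φ 0 := by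
        have h := integral_Ioi_of_hasDerivAt_of_tendsto (a := 0) (m := 0)
          (f := fun s : ℝ => φ (s * exp (θ * I)))
          (f' := fun r : ℝ => fderiv ℝ φ (r * exp (θ * I)) (exp (θ * I)))
          (hasDerivAt_radial hφ 0 θ).continuousAt.continuousWithinAt
          (fun r _ => hasDerivAt_radial hφ r θ) ?_ ?_
        · simpa using h
        · have hcr : Continuous fun r : ℝ => fderiv ℝ φ (r * exp (θ * I)) (exp (θ * I)) := by
            fun_prop
          refine (hcr.continuousOn.integrableOn_compact (isCompact_Icc (a := 0) (b := R))
            ).of_forall_sdiff_eq_zero measurableSet_Ioi fun r hr => ?_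
          rw [hfz r θ, zero_apply]
          by_contra! hlt
          exact hr.2 ⟨le_of_lt hr.1, hlt⟩
        · refine tendsto_const_nhds.congr' ?_
          filter_upwards [eventually_gt_atTop R] with r hr
          exact (image_eq_zero_of_notMem_tsupport (hzero r θ hr)).symm
      simp only [Prod.swap, this]
      rw [setIntegral_const]
      simp [Real.pi_pos.le, two_mul]
    · have := hAi
      unfold IntegrableOn at this
      rw [polarCoord_target, Measure.volume_eq_prod, ← Measure.prod_restrict] at this
      exact this.swap
  have hBint : ∫ p in polarCoord.target,
      fderiv ℝ φ (p.1 * exp (p.2 * I)) (I * exp (p.2 * I)) = 0 := by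
    change ∫ p in Ioi (0 : ℝ) ×ˢ Ioo (-Real.pi) Real.pi, _ ∂(volume.prod volume) = _
    rw [setIntegral_prod _ hBi]
    refine setIntegral_eq_zero_of_forall_eq_zero fun r hr => ?_
    have hr' : (r : ℂ) ≠ 0 := by exact_mod_cast (ne_of_gt hr)
    have h := intervalIntegral.integral_eq_sub_of_hasDerivAt (a := -Real.pi) (b := Real.pi)
      (f := fun s : ℝ => φ (r * exp (s * I)))
      (f' := fun θ : ℝ => r * fderiv ℝ φ (r * exp (θ * I)) (I * exp (θ * I)))
      (fun θ _ => hasDerivAt_angular hφ r θ)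
      (Continuous.intervalIntegrable (by fun_prop) _ _)
    rw [intervalIntegral.integral_const_mul] at h
    rw [← integral_Ioc_eq_integral_Ioo, ← intervalIntegral.integral_of_le (by linarith [Real.pi_pos])]
    refine (mul_eq_zero.1 (h.trans ?_)).resolve_left hr'
    push_cast
    rw [neg_mul, exp_neg, exp_pi_mul_I]
    norm_num
  rw [key, integral_div, integral_add hAi (hBi.const_mul I), integral_const_mul, hAint, hBint]
  ring

/-- The Cauchy–Pompeiu formula for a compactly supported function. -/
theorem integral_dbar_mul_inv_sub {φ : ℂ → ℂ} (hφ : ContDiff ℝ 1 φ) (hc : HasCompactSupport φ)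
    (z : ℂ) : ∫ w, dbar φ w * (w - z)⁻¹ = -(Real.pi * φ z) := by
  have h := integral_dbar_mul_inv (φ := fun w => φ (w + z)) (hφ.comp (contDiff_id.add contDiff_const))
    (hc.comp_homeomorph (Homeomorph.addRight z))
  rw [zero_add] at h
  rw [← h, ← integral_add_right_eq_self _ z]
  congr 1 with w
  simp only [dbar, fderiv_comp_add_right, add_sub_cancel_right]

/-! ### Local integrability of the Cauchy kernel -/

lemma integrableOn_inv_closedBall (R : ℝ) :
    IntegrableOn (fun w : ℂ => w⁻¹) (Metric.closedBall 0 R) := by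
  refine ⟨measurable_inv.aestronglyMeasurable, ?_⟩
  rw [HasFiniteIntegral, ← lintegral_indicator Metric.isClosed_closedBall.measurableSet,
    ← Complex.lintegral_comp_polarCoord_symm]
  calc _ ≤ ∫⁻ p in polarCoord.target, (Icc 0 R ×ˢ Icc (-Real.pi) Real.pi).indicator 1 p := by
        refine setLIntegral_mono' polarCoord.open_target.measurableSet fun p hp => ?_
        have hp0 : 0 < p.1 := hp.1
        by_cases h : p.1 ≤ R
        · have h1 : p ∈ Icc 0 R ×ˢ Icc (-Real.pi) Real.pi :=
            ⟨⟨hp0.le, h⟩, ⟨hp.2.1.le, hp.2.2.le⟩⟩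
          have h2 : Complex.polarCoord.symm p ∈ Metric.closedBall (0 : ℂ) R := by
            rw [mem_closedBall_zero_iff, norm_polarCoord_symm, abs_of_pos hp0]; exact h
          rw [indicator_of_mem h1, indicator_of_mem h2, enorm_inv (by
            rw [← norm_ne_zero_iff, norm_polarCoord_symm]; positivity), ← ofReal_norm,
            norm_polarCoord_symm, abs_of_pos hp0, smul_eq_mul, Pi.one_apply]
          exact ENNReal.mul_inv_le_one _
        · have h2 : Complex.polarCoord.symm p ∉ Metric.closedBall (0 : ℂ) R := by
            rw [mem_closedBall_zero_iff, norm_polarCoord_symm, abs_of_pos hp0]; exact h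
          rw [indicator_of_notMem h2, smul_zero]
          exact zero_le
    _ ≤ ∫⁻ p, (Icc 0 R ×ˢ Icc (-Real.pi) Real.pi).indicator 1 p := setLIntegral_le_lintegral _ _
    _ = volume (Icc 0 R ×ˢ Icc (-Real.pi) Real.pi) :=
        lintegral_indicator_one (measurableSet_Icc.prod measurableSet_Icc)
    _ < ⊤ := (isCompact_Icc.prod isCompact_Icc).measure_lt_top

/-- The Cauchy potentials of a bounded compactly supported function are bounded,
uniformly on bounded sets. -/
lemma exists_integral_norm_mul_inv_sub_le {ψ : ℂ → ℂ} (hψ : Continuous ψ)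
    (hc : HasCompactSupport ψ) {T : Set ℂ} (hT : Bornology.IsBounded T) :
    ∃ B, ∀ z ∈ T, Integrable (fun w => ψ w * (w - z)⁻¹) ∧
      ∫ w, ‖ψ w * (w - z)⁻¹‖ ≤ B := by
  obtain ⟨M, hM⟩ := hψ.bounded_above_of_compact_support hc
  obtain ⟨R₁, hR₁⟩ := hc.isCompact.isBounded.exists_norm_le
  obtain ⟨R₂, hR₂⟩ := hT.exists_norm_le
  -- After the translation `w = u + z` the singularity sits at `0` for every `z`, so a single
  -- integrable majorant serves all of `T`.
  set k : ℂ → ℝ := (Metric.closedBall (0 : ℂ) (R₁ + R₂)).indicator fun u => M * ‖u⁻¹‖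
  have hk : Integrable k := by
    rw [integrable_indicator_iff Metric.isClosed_closedBall.measurableSet]
    exact (integrableOn_inv_closedBall _).norm.const_mul M
  have hle (z : ℂ) (hz : z ∈ T) (u : ℂ) : ‖ψ (u + z) * u⁻¹‖ ≤ k u := by
    by_cases hu : u ∈ Metric.closedBall (0 : ℂ) (R₁ + R₂)
    · simp only [k, indicator_of_mem hu, norm_mul]
      exact mul_le_mul_of_nonneg_right (hM _) (norm_nonneg _)
    · simp only [k, indicator_of_notMem hu]
      rw [image_eq_zero_of_notMem_tsupport (f := ψ), zero_mul, norm_zero]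
      intro h
      refine hu ?_
      rw [mem_closedBall_zero_iff]
      calc ‖u‖ = ‖(u + z) - z‖ := by rw [add_sub_cancel_right]
        _ ≤ ‖u + z‖ + ‖z‖ := norm_sub_le _ _
        _ ≤ _ := add_le_add (hR₁ _ h) (hR₂ _ hz)
  have hint (z : ℂ) (hz : z ∈ T) : Integrable fun u => ψ (u + z) * u⁻¹ := by
    refine hk.mono' ?_ (.of_forall (hle z hz))
    exact ((hψ.comp (continuous_add_const z)).measurable.mul measurable_inv).aestronglyMeasurable
  refine ⟨∫ u, k u, fun z hz => ⟨?_, ?_⟩⟩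
  · simpa using (hint z hz).comp_sub_right z
  · rw [← integral_add_right_eq_self _ z]
    simp only [add_sub_cancel_right]
    exact integral_mono (hint z hz).norm hk (hle z hz)

/-! ### Integrals along one rectifiable curve -/

namespace RectifiableJordanCurve

variable (γ : RectifiableJordanCurve)

lemma continuousOn : ContinuousOn γ.toFun (Icc 0 1) :=
  γ.lipschitz.choose_spec.continuousOn

lemma isCompact_trace : IsCompact γ.trace := isCompact_Icc.image_of_continuousOn γ.continuousOn

lemma mem_trace {s : ℝ} (hs : s ∈ Ioo (0 : ℝ) 1) : γ.toFun s ∈ γ.trace :=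
  mem_image_of_mem _ (Ioo_subset_Icc_self hs)

lemma integral_eq_setIntegral (g : ℂ → ℂ) :
    γ.integral g = ∫ s in Ioo (0 : ℝ) 1, g (γ.toFun s) * deriv γ.toFun s := by
  rw [RectifiableJordanCurve.integral, intervalIntegral.integral_of_le zero_le_one,
    integral_Ioc_eq_integral_Ioo]

lemma exists_norm_deriv_le : ∃ K : ℝ, 0 ≤ K ∧ ∀ s ∈ Ioo (0 : ℝ) 1, ‖deriv γ.toFun s‖ ≤ K := by
  obtain ⟨K, hK⟩ := γ.lipschitz
  exact ⟨K, K.2, fun s hs => norm_deriv_le_of_lipschitzOn (Icc_mem_nhds hs.1 hs.2) hK⟩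

lemma integrableOn_deriv : IntegrableOn (deriv γ.toFun) (Ioo 0 1) := by
  obtain ⟨K, -, hK⟩ := γ.exists_norm_deriv_le
  exact Measure.integrableOn_of_bounded (by simp) (aestronglyMeasurable_deriv _ _)
    ((ae_restrict_iff' measurableSet_Ioo).2 (.of_forall hK))

lemma aestronglyMeasurable :
    AEStronglyMeasurable γ.toFun (volume.restrict (Ioo (0 : ℝ) 1)) :=
  (γ.continuousOn.mono Ioo_subset_Icc_self).aestronglyMeasurable measurableSet_Ioo

lemma integrableOn {g : ℂ → ℂ} (hg : ContinuousOn g γ.trace) :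
    IntegrableOn (fun s => g (γ.toFun s) * deriv γ.toFun s) (Ioo 0 1) := by
  have h : ContinuousOn (fun s => g (γ.toFun s)) (Icc (0 : ℝ) 1) :=
    hg.comp γ.continuousOn (mapsTo_image _ _)
  obtain ⟨B, hB⟩ := isCompact_Icc.exists_bound_of_continuousOn h
  refine γ.integrableOn_deriv.bdd_mul (c := B)
    ((h.mono Ioo_subset_Icc_self).aestronglyMeasurable measurableSet_Ioo) ?_
  exact (ae_restrict_iff' measurableSet_Ioo).2
    (.of_forall fun s hs => hB s (Ioo_subset_Icc_self hs))

lemma exists_norm_integral_le :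
    ∃ L : ℝ, 0 ≤ L ∧ ∀ (g : ℂ → ℂ) (c : ℝ), (∀ t ∈ γ.trace, ‖g t‖ ≤ c) →
      ‖γ.integral g‖ ≤ L * c := by
  obtain ⟨K, hK0, hK⟩ := γ.exists_norm_deriv_le
  refine ⟨K, hK0, fun g c hg => ?_⟩
  rw [integral_eq_setIntegral]
  have h := norm_setIntegral_le_of_norm_le_const (μ := volume) (s := Ioo (0 : ℝ) 1)
    (f := fun s => g (γ.toFun s) * deriv γ.toFun s) (C := K * c) (by simp) fun s hs => by
      rw [norm_mul, mul_comm]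
      exact mul_le_mul (hK s hs) (hg _ (γ.mem_trace hs)) (norm_nonneg _) hK0
  simpa using h

lemma integral_sub {g h : ℂ → ℂ} (hg : ContinuousOn g γ.trace) (hh : ContinuousOn h γ.trace) :
    γ.integral (fun t => g t - h t) = γ.integral g - γ.integral h := by
  simp only [integral_eq_setIntegral, sub_mul]
  exact MeasureTheory.integral_sub (γ.integrableOn hg) (γ.integrableOn hh)

lemma integral_const_mul (c : ℂ) (g : ℂ → ℂ) :
    γ.integral (fun t => c * g t) = c * γ.integral g := by
  simp only [integral_eq_setIntegral, mul_assoc]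
  exact MeasureTheory.integral_const_mul _ _

lemma integral_congr {g h : ℂ → ℂ} (H : EqOn g h γ.trace) : γ.integral g = γ.integral h := by
  simp only [integral_eq_setIntegral]
  exact setIntegral_congr_fun measurableSet_Ioo fun s hs => by
    simp only [H (γ.mem_trace hs)]

lemma integral_finset_sum {ι : Type*} (S : Finset ι) {g : ι → ℂ → ℂ}
    (hg : ∀ i ∈ S, ContinuousOn (g i) γ.trace) :
    γ.integral (fun t => ∑ i ∈ S, g i t) = ∑ i ∈ S, γ.integral (g i) := by
  simp only [integral_eq_setIntegral, Finset.sum_mul]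
  exact MeasureTheory.integral_finsetSum _ fun i hi => γ.integrableOn (hg i hi)

/-- A tubular neighbourhood of a rectifiable curve has area of the order of its width. -/
lemma exists_volume_cthickening_le : ∃ C : ℝ, 0 ≤ C ∧ ∀ ε : ℝ, 0 < ε → ε ≤ 1 →
    volume (Metric.cthickening ε γ.trace) ≤ ENNReal.ofReal (C * ε) := by
  obtain ⟨K, hK⟩ := γ.lipschitz
  refine ⟨3 * ((K + 1) ^ 2 * Real.pi), by positivity, fun ε hε hε1 => ?_⟩
  -- Sample the curve at the parameters `j / N`. Every parameter is within `ε` of a sample, hence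
  -- every curve point within `K * ε` of a sample point, and balls of radius `(K + 1) * ε` cover the
  -- neighbourhood. The constant `3` comes from `(N + 1) * ε ≤ 1 + 2 * ε`.
  set N := ⌈1 / ε⌉₊
  have hN1 : 1 / ε ≤ N := Nat.le_ceil _
  have hN0 : (0 : ℝ) < N := lt_of_lt_of_le (by positivity) hN1
  have hN2 : (N : ℝ) < 1 / ε + 1 := Nat.ceil_lt_add_one (by positivity)
  have hcov : Metric.cthickening ε γ.trace ⊆ ⋃ j ∈ Finset.range (N + 1),
      Metric.closedBall (γ.toFun (j / N)) ((K + 1) * ε) := by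
    rw [γ.isCompact_trace.cthickening_eq_biUnion_closedBall hε.le]
    intro w hw
    simp only [mem_iUnion] at hw
    obtain ⟨_, ⟨s, hs, rfl⟩, hw⟩ := hw
    rw [Metric.mem_closedBall] at hw
    have hj1 : (⌊s * N⌋₊ : ℝ) ≤ s * N := Nat.floor_le (mul_nonneg hs.1 hN0.le)
    have hj2 : s * N < ⌊s * N⌋₊ + 1 := Nat.lt_floor_add_one _
    have hj3 : ⌊s * N⌋₊ ≤ N := Nat.floor_le_of_le (by nlinarith [hs.2])
    simp only [mem_iUnion]
    refine ⟨⌊s * N⌋₊, Finset.mem_range.2 (Nat.lt_succ_of_le hj3), ?_⟩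
    have hmem : (⌊s * N⌋₊ : ℝ) / N ∈ Icc (0 : ℝ) 1 :=
      ⟨by positivity, (div_le_one hN0).2 (by exact_mod_cast hj3)⟩
    have hd : dist s (⌊s * N⌋₊ / N) ≤ ε := by
      have h1 : 1 / (N : ℝ) ≤ ε := by
        rw [div_le_iff₀ hε] at hN1
        rw [div_le_iff₀ hN0]; linarith
      refine le_trans ?_ h1
      rw [Real.dist_eq, abs_le, le_sub_iff_add_le, sub_le_iff_le_add, ← add_div, le_div_iff₀ hN0]
      constructor
      · rw [← sub_eq_neg_add, ← sub_div, div_le_iff₀ hN0]; linarith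
      · linarith
    have hlip := hK.dist_le_mul s hs _ hmem
    rw [Metric.mem_closedBall]
    calc _ ≤ dist w (γ.toFun s) + dist (γ.toFun s) _ := dist_triangle _ _ _
      _ ≤ ε + K * ε := add_le_add hw (hlip.trans (mul_le_mul_of_nonneg_left hd K.2))
      _ = _ := by ring
  refine (measure_mono hcov).trans ((measure_biUnion_finset_le _ _).trans ?_)
  simp only [Complex.volume_closedBall, Finset.sum_const, Finset.card_range, nsmul_eq_mul]
  have hpi : (NNReal.pi : ENNReal) = ENNReal.ofReal Real.pi := by
    rw [← NNReal.coe_real_pi, ENNReal.ofReal_coe_nnreal]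
  rw [hpi, ← ENNReal.ofReal_pow (by positivity), ← ENNReal.ofReal_mul (by positivity),
    ← ENNReal.ofReal_natCast, ← ENNReal.ofReal_mul (by positivity)]
  refine ENNReal.ofReal_le_ofReal ?_
  have h3 : ((N + 1 : ℕ) : ℝ) * ε ≤ 3 := by
    push_cast
    have : (1 / ε + 1) * ε = 1 + ε := by field_simp
    nlinarith
  calc _ = ((N + 1 : ℕ) * ε) * ((K + 1) ^ 2 * Real.pi * ε) := by ring
    _ ≤ 3 * ((K + 1) ^ 2 * Real.pi * ε) := mul_le_mul_of_nonneg_right h3 (by positivity)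
    _ = _ := by ring

/-- Integrating the Cauchy–Pompeiu formula along a curve. -/
lemma integral_eq_integral_dbar {φ : ℂ → ℂ} (hφ : ContDiff ℝ 1 φ) (hc : HasCompactSupport φ) :
    Integrable (fun w => dbar φ w * γ.integral fun t => (t - w)⁻¹) ∧
      γ.integral φ = (Real.pi : ℂ)⁻¹ * ∫ w, dbar φ w * γ.integral fun t => (t - w)⁻¹ := by
  have hpi : (Real.pi : ℂ) ≠ 0 := by exact_mod_cast Real.pi_ne_zero
  set ψ := dbar φ
  have hψ : Continuous ψ := continuous_dbar hφ
  have hψc : HasCompactSupport ψ := hasCompactSupport_dbar hc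
  obtain ⟨B, hB⟩ := exists_integral_norm_mul_inv_sub_le hψ hψc γ.isCompact_trace.isBounded
  obtain ⟨K, hK0, hK⟩ := γ.exists_norm_deriv_le
  set μ := (volume : Measure ℝ).restrict (Ioo (0 : ℝ) 1)
  set G : ℝ → ℂ → ℂ := fun s w => ψ w * (w - γ.toFun s)⁻¹ * deriv γ.toFun s
  have hmeas : AEStronglyMeasurable (Function.uncurry G) (μ.prod volume) := by
    have h1 : AEStronglyMeasurable (fun p : ℝ × ℂ => γ.toFun p.1) (μ.prod volume) :=
      γ.aestronglyMeasurable.comp_fst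
    have h2 : AEStronglyMeasurable (fun p : ℝ × ℂ => deriv γ.toFun p.1) (μ.prod volume) :=
      (aestronglyMeasurable_deriv γ.toFun μ).comp_fst
    have h3 : AEStronglyMeasurable (fun p : ℝ × ℂ => ψ p.2) (μ.prod volume) :=
      (hψ.comp continuous_snd).aestronglyMeasurable
    have h4 : AEStronglyMeasurable (fun p : ℝ × ℂ => p.2) (μ.prod volume) :=
      continuous_snd.aestronglyMeasurable
    exact (h3.mul (h4.sub h1).aemeasurable.inv.aestronglyMeasurable).mul h2
  -- Fubini is justified despite the singularity at `w = γ s`: the integral over `w` of the absolute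
  -- value is bounded uniformly in `s`.
  have hint : Integrable (Function.uncurry G) (μ.prod volume) := by
    rw [integrable_prod_iff hmeas]
    constructor
    · refine (ae_restrict_iff' measurableSet_Ioo).2 (.of_forall fun s hs => ?_)
      exact (hB _ (γ.mem_trace hs)).1.mul_const (deriv γ.toFun s)
    · refine Integrable.of_bound hmeas.norm.integral_prod_right' (B * K) ?_
      refine (ae_restrict_iff' measurableSet_Ioo).2 (.of_forall fun s hs => ?_)
      simp only [Function.uncurry, G]
      have h1 := (hB _ (γ.mem_trace hs)).2
      rw [Real.norm_of_nonneg (integral_nonneg fun _ => norm_nonneg _)]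
      simp only [norm_mul (ψ _ * _)]
      rw [MeasureTheory.integral_mul_const]
      exact mul_le_mul h1 (hK s hs) (norm_nonneg _)
        ((integral_nonneg fun _ => norm_nonneg _).trans h1)
  have hinner (w : ℂ) : ∫ s, G s w ∂μ = -(ψ w * γ.integral fun t => (t - w)⁻¹) := by
    rw [integral_eq_setIntegral, ← mul_neg, ← MeasureTheory.integral_neg,
      ← MeasureTheory.integral_const_mul]
    congr 1 with s
    rw [← neg_sub, inv_neg]
    ring
  constructor
  · have := hint.integral_prod_right
    simp only [Function.uncurry, hinner] at this
    simpa using this.neg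
  · have hswap := integral_integral_swap hint
    simp only [hinner] at hswap
    rw [MeasureTheory.integral_neg] at hswap
    rw [← neg_eq_iff_eq_neg.2 hswap, integral_eq_setIntegral, ← MeasureTheory.integral_neg,
      ← MeasureTheory.integral_const_mul]
    congr 1 with s
    simp only [G]
    rw [MeasureTheory.integral_mul_const, integral_dbar_mul_inv_sub hφ hc]
    field_simp

end RectifiableJordanCurve

/-! ### Systems of curves and continuity of the winding number -/

variable {k : ℕ} (Γ : Fin k → RectifiableJordanCurve)

lemma isCompact_traceOf : IsCompact (traceOf Γ) :=
  isCompact_iUnion fun a => (Γ a).isCompact_trace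

lemma trace_subset_traceOf (a : Fin k) : (Γ a).trace ⊆ traceOf Γ :=
  subset_iUnion (fun a => (Γ a).trace) a

lemma exists_norm_integralOver_le :
    ∃ L : ℝ, 0 ≤ L ∧ ∀ (g : ℂ → ℂ) (c : ℝ), (∀ t ∈ traceOf Γ, ‖g t‖ ≤ c) →
      ‖integralOver Γ g‖ ≤ L * c := by
  choose L hL0 hL using fun a => (Γ a).exists_norm_integral_le
  refine ⟨∑ a, L a, Finset.sum_nonneg fun a _ => hL0 a, fun g c hg => ?_⟩
  rw [Finset.sum_mul]
  exact norm_sum_le_of_le _ fun a _ => hL a g c fun t ht => hg t (trace_subset_traceOf Γ a ht)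

lemma integralOver_sub {g h : ℂ → ℂ} (hg : ContinuousOn g (traceOf Γ))
    (hh : ContinuousOn h (traceOf Γ)) :
    integralOver Γ (fun t => g t - h t) = integralOver Γ g - integralOver Γ h := by
  simp only [integralOver, ← Finset.sum_sub_distrib]
  exact Finset.sum_congr rfl fun a _ => (Γ a).integral_sub
    (hg.mono (trace_subset_traceOf Γ a)) (hh.mono (trace_subset_traceOf Γ a))

lemma integralOver_const_mul (c : ℂ) (g : ℂ → ℂ) :
    integralOver Γ (fun t => c * g t) = c * integralOver Γ g := by
  simp only [integralOver, RectifiableJordanCurve.integral_const_mul, Finset.mul_sum]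

lemma integralOver_congr {g h : ℂ → ℂ} (H : EqOn g h (traceOf Γ)) :
    integralOver Γ g = integralOver Γ h :=
  Finset.sum_congr rfl fun a _ => (Γ a).integral_congr (H.mono (trace_subset_traceOf Γ a))

lemma integralOver_finset_sum {ι : Type*} (S : Finset ι) {g : ι → ℂ → ℂ}
    (hg : ∀ i ∈ S, ContinuousOn (g i) (traceOf Γ)) :
    integralOver Γ (fun t => ∑ i ∈ S, g i t) = ∑ i ∈ S, integralOver Γ (g i) := by
  simp only [integralOver]
  rw [Finset.sum_comm]
  exact Finset.sum_congr rfl fun a _ => (Γ a).integral_finset_sum S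
    fun i hi => (hg i hi).mono (trace_subset_traceOf Γ a)

lemma exists_volume_cthickening_traceOf_le : ∃ C : ℝ, 0 ≤ C ∧ ∀ ε : ℝ, 0 < ε → ε ≤ 1 →
    volume (Metric.cthickening ε (traceOf Γ)) ≤ ENNReal.ofReal (C * ε) := by
  choose C hC0 hC using fun a => (Γ a).exists_volume_cthickening_le
  refine ⟨∑ a, C a, Finset.sum_nonneg fun a _ => hC0 a, fun ε hε hε1 => ?_⟩
  have hsub : Metric.cthickening ε (traceOf Γ) ⊆ ⋃ a, Metric.cthickening ε (Γ a).trace := by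
    rw [(isCompact_traceOf Γ).cthickening_eq_biUnion_closedBall hε.le]
    simp only [traceOf, mem_iUnion, iUnion_exists]
    refine iUnion_subset fun t => iUnion_subset fun a => iUnion_subset fun ht => ?_
    exact (Metric.closedBall_subset_cthickening ht ε).trans
      (subset_iUnion (fun a => Metric.cthickening ε (Γ a).trace) a)
  refine (measure_mono hsub).trans ((measure_iUnion_fintype_le _ _).trans ?_)
  rw [Finset.sum_mul, ENNReal.ofReal_sum_of_nonneg fun a _ => mul_nonneg (hC0 a) hε.le]
  exact Finset.sum_le_sum fun a _ => hC a ε hε hε1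

lemma volume_traceOf : volume (traceOf Γ) = 0 := by
  obtain ⟨C, hC0, hC⟩ := exists_volume_cthickening_traceOf_le Γ
  have h1 : Tendsto (fun ε : ℝ => ENNReal.ofReal (C * ε)) (𝓝[>] 0) (𝓝 0) := by
    have : Tendsto (fun ε : ℝ => ENNReal.ofReal (C * ε)) (𝓝 0) (𝓝 (ENNReal.ofReal (C * 0))) :=
      (ENNReal.continuous_ofReal.comp (continuous_const_mul C)).tendsto 0
    rw [mul_zero, ENNReal.ofReal_zero] at this
    exact this.mono_left nhdsWithin_le_nhds
  refine le_antisymm (ge_of_tendsto h1 ?_) zero_le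
  filter_upwards [Ioc_mem_nhdsGT zero_lt_one] with ε hε
  exact (measure_mono (Metric.self_subset_cthickening _)).trans (hC ε hε.1 hε.2)

lemma continuousOn_inv_sub {z : ℂ} {T : Set ℂ} (hz : z ∉ T) :
    ContinuousOn (fun t : ℂ => (t - z)⁻¹) T :=
  (continuousOn_id.sub continuousOn_const).inv₀ fun t ht h =>
    hz (by rwa [← show t = z from sub_eq_zero.1 h])

/-- Dominated convergence: for `z` near `z₀` the distance from `z` to the curves stays above `δ /
2`, which bounds the kernel. -/
lemma continuousOn_windingNumber : ContinuousOn (windingNumber Γ) (traceOf Γ)ᶜ := by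
  intro z₀ hz₀
  refine ContinuousAt.continuousWithinAt ?_
  obtain ⟨δ, hδ, hball⟩ := Metric.isOpen_iff.1 (isCompact_traceOf Γ).isClosed.isOpen_compl z₀ hz₀
  unfold windingNumber integralOver
  refine continuousAt_const.mul (tendsto_finsetSum _ fun a _ => ?_)
  simp only [RectifiableJordanCurve.integral_eq_setIntegral]
  obtain ⟨K, hK0, hK⟩ := (Γ a).exists_norm_deriv_le
  have hfar : ∀ z ∈ Metric.ball z₀ (δ / 2), ∀ t ∈ (Γ a).trace, δ / 2 ≤ ‖t - z‖ := by
    intro z hz t ht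
    by_contra! h
    refine hball (?_ : t ∈ Metric.ball z₀ δ) (trace_subset_traceOf Γ a ht)
    rw [Metric.mem_ball] at hz ⊢
    rw [← dist_eq_norm] at h
    linarith [dist_triangle t z z₀]
  have hmem : ∀ z ∈ Metric.ball z₀ (δ / 2), z ∉ (Γ a).trace := fun z hz h => by
    have := hfar z hz z h
    simp at this; linarith
  have hnhds : Metric.ball z₀ (δ / 2) ∈ 𝓝 z₀ := Metric.ball_mem_nhds _ (by positivity)
  refine continuousAt_of_dominated (bound := fun _ => (δ / 2)⁻¹ * K) ?_ ?_
    (integrable_const _) ?_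
  · filter_upwards [hnhds] with z hz
    exact ((Γ a).integrableOn (continuousOn_inv_sub (hmem z hz))).aestronglyMeasurable
  · filter_upwards [hnhds] with z hz
    refine (ae_restrict_iff' measurableSet_Ioo).2 (.of_forall fun s hs => ?_)
    rw [norm_mul, norm_inv]
    exact mul_le_mul (inv_anti₀ (by positivity) (hfar z hz _ ((Γ a).mem_trace hs))) (hK s hs)
      (norm_nonneg _) (by positivity)
  · refine (ae_restrict_iff' measurableSet_Ioo).2 (.of_forall fun s hs => ?_)
    refine ContinuousAt.mul (ContinuousAt.inv₀ (by fun_prop) ?_) continuousAt_const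
    rw [sub_ne_zero]
    rintro rfl
    exact hz₀ (trace_subset_traceOf Γ a ((Γ a).mem_trace hs))

/-! ### The enclosed region and Green's formula -/

variable {Γ}

/-- At a point farther than `L + 1` from the curves the kernel integral has norm below `1`, whereas
winding number `1` requires norm `2π`. -/
lemma isBounded_inside : Bornology.IsBounded (inside Γ) := by
  obtain ⟨L, hL0, hL⟩ := exists_norm_integralOver_le Γ
  obtain ⟨R, hR⟩ := (isCompact_traceOf Γ).isBounded.exists_norm_le
  rw [isBounded_iff_forall_norm_le]
  refine ⟨R + L + 1, fun z hz => ?_⟩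
  by_contra! hlt
  have h1 := hL (fun t => (t - z)⁻¹) (L + 1)⁻¹ fun t ht => by
    rw [norm_inv]
    refine inv_anti₀ (by positivity) ?_
    rw [← norm_neg, neg_sub]
    linarith [norm_sub_norm_le z t, hR t ht]
  have h2 : L * (L + 1)⁻¹ < 1 := by
    rw [mul_inv_lt_iff₀ (by positivity)]; linarith
  have h3 : integralOver Γ (fun t => (t - z)⁻¹) = 2 * Real.pi * I := by
    have h4 := hz.2
    rw [windingNumber, inv_mul_eq_iff_eq_mul₀ (by simp [Real.pi_ne_zero])] at h4
    rw [h4, mul_one]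
  rw [h3] at h1
  simp only [norm_mul, RCLike.norm_ofNat, norm_real, norm_I, Real.norm_eq_abs,
    abs_of_pos Real.pi_pos, mul_one] at h1
  linarith [Real.pi_gt_three]

namespace IsPositiveJordanSystem

/-- A continuous function with values in the discrete set `{0, 1}` is constant on connected sets.
This gives openness of the region, closedness of its union with the curves, and that a ball centred
inside and missing the curves stays inside. -/
lemma windingNumber_eq_of_isPreconnected (hΓ : IsPositiveJordanSystem Γ)
    {S : Set ℂ} (hS : IsPreconnected S)
    (hd : S ⊆ (traceOf Γ)ᶜ) {z w : ℂ} (hz : z ∈ S) (hw : w ∈ S) :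
    windingNumber Γ z = windingNumber Γ w := by
  have hT : IsDiscrete ({0, 1} : Set ℂ) := (Set.toFinite _).isDiscrete
  refine hS.constant_of_mapsTo hT ((continuousOn_windingNumber Γ).mono hd) (fun y hy => ?_) hz hw
  exact hΓ.winding y (hd hy)

lemma subset_inside (hΓ : IsPositiveJordanSystem Γ)
    {S : Set ℂ} (hS : IsPreconnected S) (hd : S ⊆ (traceOf Γ)ᶜ) {z : ℂ}
    (hz : z ∈ S) (hzi : z ∈ inside Γ) : S ⊆ inside Γ := fun _ hw =>
  ⟨hd hw, (hΓ.windingNumber_eq_of_isPreconnected hS hd hw hz).trans hzi.2⟩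

lemma isOpen_inside (hΓ : IsPositiveJordanSystem Γ) : IsOpen (inside Γ) := by
  rw [Metric.isOpen_iff]
  intro z hz
  obtain ⟨δ, hδ, h⟩ := Metric.isOpen_iff.1 (isCompact_traceOf Γ).isClosed.isOpen_compl z hz.1
  exact ⟨δ, hδ, hΓ.subset_inside (convex_ball _ _).isPreconnected h (Metric.mem_ball_self hδ) hz⟩

lemma isClosed_inside_union_traceOf (hΓ : IsPositiveJordanSystem Γ) :
    IsClosed (inside Γ ∪ traceOf Γ) := by
  rw [← isOpen_compl_iff, Metric.isOpen_iff]
  intro z hz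
  simp only [mem_compl_iff, mem_union, not_or] at hz
  obtain ⟨δ, hδ, h⟩ := Metric.isOpen_iff.1 (isCompact_traceOf Γ).isClosed.isOpen_compl z hz.2
  refine ⟨δ, hδ, fun w hw hw' => ?_⟩
  rcases hw' with hw' | hw'
  · exact hz.1 (hΓ.subset_inside (convex_ball _ _).isPreconnected h hw hw'
      (Metric.mem_ball_self hδ))
  · exact h hw hw'

lemma isCompact_inside_union_traceOf (hΓ : IsPositiveJordanSystem Γ) :
    IsCompact (inside Γ ∪ traceOf Γ) :=
  Metric.isCompact_of_isClosed_isBounded hΓ.isClosed_inside_union_traceOf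
    (isBounded_inside.union (isCompact_traceOf Γ).isBounded)

/-- Green's formula for a positively oriented Jordan system. -/
theorem integralOver_eq_setIntegral_dbar (hΓ : IsPositiveJordanSystem Γ)
    {φ : ℂ → ℂ} (hφ : ContDiff ℝ 1 φ)
    (hc : HasCompactSupport φ) :
    integralOver Γ φ = 2 * I * ∫ w in inside Γ, dbar φ w := by
  have hpi : (Real.pi : ℂ) ≠ 0 := by exact_mod_cast Real.pi_ne_zero
  have h1 : integralOver Γ φ =
      (Real.pi : ℂ)⁻¹ * ∫ w, dbar φ w * integralOver Γ fun t => (t - w)⁻¹ := by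
    simp only [integralOver, Finset.mul_sum]
    rw [integral_finsetSum _ fun a _ => ((Γ a).integral_eq_integral_dbar hφ hc).1, Finset.mul_sum]
    exact Finset.sum_congr rfl fun a _ => ((Γ a).integral_eq_integral_dbar hφ hc).2
  -- The curves have zero area; elsewhere the kernel integral is `2πi` inside and `0` outside. With
  -- the factor `1/π` this yields `2i`.
  have h2 : (fun w => dbar φ w * integralOver Γ fun t => (t - w)⁻¹) =ᵐ[volume]
      (inside Γ).indicator fun w => 2 * Real.pi * I * dbar φ w := by
    have h0 : ∀ᵐ w, w ∉ traceOf Γ := measure_eq_zero_iff_ae_notMem.1 (volume_traceOf Γ)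
    filter_upwards [h0] with w hw
    have h3 : integralOver Γ (fun t => (t - w)⁻¹) = 2 * Real.pi * I * windingNumber Γ w := by
      rw [windingNumber, mul_inv_cancel_left₀ (by simp [Real.pi_ne_zero])]
    rw [h3]
    by_cases hi : w ∈ inside Γ
    · rw [indicator_of_mem hi, hi.2]; ring
    · rw [indicator_of_notMem hi, (hΓ.winding w hw).resolve_right fun h => hi ⟨hw, h⟩]; ring
  rw [h1, integral_congr_ae h2, integral_indicator hΓ.isOpen_inside.measurableSet,
    MeasureTheory.integral_const_mul]
  field_simp

end IsPositiveJordanSystem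

/-! ### Mollification at scale `ε` -/

lemma exists_mollifier : ∃ η : ℂ → ℝ, ContDiff ℝ 1 η ∧ Function.support η ⊆ Metric.ball 0 1 ∧
    (∀ u, 0 ≤ η u) ∧ ∫ u, η u = 1 := by
  let b : ContDiffBump (0 : ℂ) := ⟨1 / 2, 1, by norm_num, by norm_num⟩
  exact ⟨b.normed volume, b.contDiff_normed, b.support_normed_eq.subset, b.nonneg_normed,
    b.integral_normed⟩

/-- The average `∫ η(u) F(w - εu) du`. -/
noncomputable def mollify (η : ℂ → ℝ) (ε : ℝ) (F : ℂ → ℂ) (w : ℂ) : ℂ :=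
  ∫ u, η u • F (w - ε • u)

/-- Rescaling by `ε` makes the kernel `η` independent of the scale, so smoothness and support follow
from those of convolutions with `η`. -/
lemma mollify_eq_convolution {η : ℂ → ℝ} {F : ℂ → ℂ} {ε : ℝ} (hε : 0 < ε) :
    mollify η ε F = fun w =>
      (η ⋆[ContinuousLinearMap.lsmul ℝ ℝ, volume] fun v => F (ε • v)) (ε⁻¹ • w) := by
  ext w
  rw [convolution_lsmul, mollify]
  congr 1 with u : 1
  rw [smul_sub, smul_inv_smul₀ hε.ne']

lemma hasCompactSupport_of_support_subset_ball {η : ℂ → ℝ}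
    (hs : Function.support η ⊆ Metric.ball 0 1) : HasCompactSupport η :=
  HasCompactSupport.intro (isCompact_closedBall (0 : ℂ) 1) fun u hu => by
    by_contra h
    exact hu (Metric.ball_subset_closedBall (hs h))

lemma contDiff_mollify {η : ℂ → ℝ} (hη : ContDiff ℝ 1 η)
    (hs : Function.support η ⊆ Metric.ball 0 1) {F : ℂ → ℂ} (hF : Continuous F) {ε : ℝ} (hε : 0 < ε) :
    ContDiff ℝ 1 (mollify η ε F) := by
  rw [mollify_eq_convolution hε]
  have h : ContDiff ℝ (1 : ℕ∞)
      (η ⋆[ContinuousLinearMap.lsmul ℝ ℝ, volume] fun v => F (ε • v)) :=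
    (hasCompactSupport_of_support_subset_ball hs).contDiff_convolution_left _ hη
      (hF.comp (continuous_const_smul ε)).locallyIntegrable
  exact h.comp (contDiff_const_smul _)

lemma hasCompactSupport_mollify {η : ℂ → ℝ} (hs : Function.support η ⊆ Metric.ball 0 1)
    {F : ℂ → ℂ} {ε : ℝ} (hε : 0 < ε) (hc : HasCompactSupport F) :
    HasCompactSupport (mollify η ε F) := by
  rw [mollify_eq_convolution hε]
  have h : HasCompactSupport fun v => F (ε • v) :=
    hc.comp_homeomorph (Homeomorph.smulOfNeZero ε hε.ne')
  exact ((hasCompactSupport_of_support_subset_ball hs).convolution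
    (ContinuousLinearMap.lsmul ℝ ℝ) h).comp_homeomorph
      (Homeomorph.smulOfNeZero ε⁻¹ (inv_ne_zero hε.ne'))

lemma integrable_mollify_integrand {η : ℂ → ℝ} (hη : ContDiff ℝ 1 η)
    (hs : Function.support η ⊆ Metric.ball 0 1) {F : ℂ → ℂ} (hF : Continuous F) (ε : ℝ) (w : ℂ) :
    Integrable fun u => η u • F (w - ε • u) := by
  refine Continuous.integrable_of_hasCompactSupport ?_ ?_
  · have := hη.continuous
    fun_prop
  · exact (hasCompactSupport_of_support_subset_ball hs).smul_right

lemma norm_sub_mollify_le {η : ℂ → ℝ} (hη : ContDiff ℝ 1 η)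
    (hs : Function.support η ⊆ Metric.ball 0 1) {F : ℂ → ℂ} (hF : Continuous F) {ε : ℝ} (hε : 0 < ε)
    (hη0 : ∀ u, 0 ≤ η u) (h1 : ∫ u, η u = 1) {c : ℝ}
    (hc : ∀ v w, dist v w ≤ ε → ‖F v - F w‖ ≤ c) (w : ℂ) : ‖F w - mollify η ε F w‖ ≤ c := by
  have hηi : Integrable η :=
    hη.continuous.integrable_of_hasCompactSupport (hasCompactSupport_of_support_subset_ball hs)
  have h2 : F w - mollify η ε F w = ∫ u, η u • (F w - F (w - ε • u)) := by
    simp only [smul_sub]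
    rw [integral_sub (hηi.smul_const _) (integrable_mollify_integrand hη hs hF ε w),
      integral_smul_const, h1, one_smul, mollify]
  rw [h2]
  calc _ ≤ ∫ u, η u * c := by
        refine norm_integral_le_of_norm_le (hηi.mul_const c) (.of_forall fun u => ?_)
        rw [norm_smul, Real.norm_of_nonneg (hη0 u)]
        by_cases hu : u ∈ Function.support η
        · refine mul_le_mul_of_nonneg_left (hc _ _ ?_) (hη0 u)
          have := (mem_ball_zero_iff.1 (hs hu)).le
          rw [dist_eq_norm, sub_sub_cancel, norm_smul, Real.norm_of_nonneg hε.le]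
          exact mul_le_of_le_one_right hε.le this
        · rw [Function.notMem_support.1 hu, zero_mul, zero_mul]
    _ = c := by rw [integral_mul_const, h1, one_mul]

/-- As `η` has integral `1`, subtracting the constant `F w` from `F` changes the average only by a
constant. The derivative then falls on `η` and is paired with the oscillation of `F` at scale `ε`;
the rescaling contributes `ε⁻¹`. -/
lemma norm_fderiv_mollify_le {η : ℂ → ℝ} (hη : ContDiff ℝ 1 η)
    (hs : Function.support η ⊆ Metric.ball 0 1) {F : ℂ → ℂ} (hF : Continuous F) {ε : ℝ} (hε : 0 < ε)
    (h1 : ∫ u, η u = 1) {c : ℝ}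
    (hc : ∀ v w, dist v w ≤ ε → ‖F v - F w‖ ≤ c) (w : ℂ) :
    ‖fderiv ℝ (mollify η ε F) w‖ ≤ ε⁻¹ * (c * ∫ u, ‖fderiv ℝ η u‖) := by
  have hηc := hasCompactSupport_of_support_subset_ball hs
  have hηi : Integrable η := hη.continuous.integrable_of_hasCompactSupport hηc
  set L : ℝ →L[ℝ] ℂ →L[ℝ] ℂ := ContinuousLinearMap.lsmul ℝ ℝ
  set H : ℂ → ℂ := fun v => F (ε • v) - F w
  have hH : Continuous H := by fun_prop
  have hD := hηc.hasFDerivAt_convolution_left L hη hH.locallyIntegrable (ε⁻¹ • w) (μ := volume)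
  have heq : mollify η ε F = fun v => (η ⋆[L, volume] H) (ε⁻¹ • v) + F w := by
    ext v
    have h2 : ∫ u, η u • (F (v - ε • u) - F w) = mollify η ε F v - F w := by
      simp only [smul_sub]
      rw [integral_sub (integrable_mollify_integrand hη hs hF ε v) (hηi.smul_const _),
        integral_smul_const, h1, one_smul, mollify]
    rw [convolution_lsmul, eq_comm, ← eq_sub_iff_add_eq, ← h2]
    congr 1 with u : 1
    simp only [H]
    rw [smul_sub ε, smul_inv_smul₀ hε.ne']
  have hD2 := (hD.comp w ((hasFDerivAt_id (𝕜 := ℝ) w).const_smul ε⁻¹)).add_const (F w)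
  rw [heq]
  refine (congrArg norm hD2.fderiv).trans_le ?_
  have hbound : ‖(fderiv ℝ η ⋆[L.precompL ℂ, volume] H) (ε⁻¹ • w)‖ ≤
      c * ∫ u, ‖fderiv ℝ η u‖ := by
    rw [convolution_def, ← integral_const_mul]
    have hint : Integrable fun u => ‖fderiv ℝ η u‖ :=
      ((hη.continuous_fderiv one_ne_zero).integrable_of_hasCompactSupport (hηc.fderiv ℝ)).norm
    refine norm_integral_le_of_norm_le (hint.const_mul c) (.of_forall fun u => ?_)
    by_cases hu : u ∈ Metric.closedBall (0 : ℂ) 1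
    · have h3 : ‖H (ε⁻¹ • w - u)‖ ≤ c := by
        refine hc _ _ ?_
        rw [smul_sub, smul_inv_smul₀ hε.ne', dist_eq_norm, sub_sub_cancel_left, norm_neg,
          norm_smul, Real.norm_of_nonneg hε.le]
        exact mul_le_of_le_one_right hε.le (mem_closedBall_zero_iff.1 hu)
      have h4 : ‖L.precompL ℂ‖ ≤ 1 :=
        (L.norm_precompL_le ℂ).trans ContinuousLinearMap.opNorm_lsmul_le
      calc _ ≤ ‖L.precompL ℂ‖ * ‖fderiv ℝ η u‖ * ‖H (ε⁻¹ • w - u)‖ :=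
            (L.precompL ℂ).le_opNorm₂ _ _
        _ ≤ 1 * ‖fderiv ℝ η u‖ * c := by gcongr
        _ = _ := by ring
    · have h3 : fderiv ℝ η u = 0 := by
        by_contra h
        refine hu (closure_minimal (hs.trans Metric.ball_subset_closedBall)
          Metric.isClosed_closedBall (support_fderiv_subset ℝ h))
      simp [h3]
  refine (ContinuousLinearMap.opNorm_comp_le _ _).trans ?_
  rw [mul_comm]
  refine mul_le_mul ?_ hbound (norm_nonneg _) (by positivity)
  refine (norm_smul_le _ _).trans ?_
  rw [Real.norm_of_nonneg (by positivity)]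
  exact mul_le_of_le_one_right (by positivity) ContinuousLinearMap.norm_id_le

/-- Differentiation under the integral sign: the average sees `F` only within `ε` of its argument.
Half of the slack `r - ε` lets the argument move while these points stay in a compact ball on which
`deriv F` is bounded. -/
lemma differentiableAt_mollify {η : ℂ → ℝ} (hη : ContDiff ℝ 1 η)
    (hs : Function.support η ⊆ Metric.ball 0 1) {F : ℂ → ℂ} (hF : Continuous F) {ε : ℝ} (hε : 0 < ε)
    {w : ℂ} {r : ℝ} (hr : ε < r)
    (hd : DifferentiableOn ℂ F (Metric.ball w r)) :
    DifferentiableAt ℂ (mollify η ε F) w := by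
  set δ := (r - ε) / 2
  have hδ : 0 < δ := by simp only [δ]; linarith
  have hδr : ε + δ < r := by simp only [δ]; linarith
  have hd' : ContinuousOn (deriv F) (Metric.closedBall w (ε + δ)) :=
    (hd.deriv Metric.isOpen_ball).continuousOn.mono (Metric.closedBall_subset_ball hδr)
  obtain ⟨M, hM⟩ := (isCompact_closedBall w (ε + δ)).exists_bound_of_continuousOn hd'
  have hηi : Integrable η := hη.continuous.integrable_of_hasCompactSupport
    (hasCompactSupport_of_support_subset_ball hs)
  have hmem {u w' : ℂ} (hu : u ∈ Function.support η) (hw' : w' ∈ Metric.ball w δ) :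
      w' - ε • u ∈ Metric.closedBall w (ε + δ) := by
    have h1 := (mem_ball_zero_iff.1 (hs hu)).le
    rw [mem_ball_iff_norm] at hw'
    rw [mem_closedBall_iff_norm]
    calc ‖w' - ε • u - w‖ = ‖(w' - w) - ε • u‖ := by congr 1; ring
      _ ≤ ‖w' - w‖ + ‖ε • u‖ := norm_sub_le _ _
      _ ≤ δ + ε * 1 := by
        rw [norm_smul, Real.norm_of_nonneg hε.le]
        gcongr
      _ = _ := by ring
  have h := hasDerivAt_integral_of_dominated_loc_of_deriv_le (μ := volume) (𝕜 := ℂ)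
    (F := fun w' u => η u • F (w' - ε • u)) (x₀ := w) (s := Metric.ball w δ)
    (F' := fun w' u => η u • deriv F (w' - ε • u)) (bound := fun u => ‖η u‖ * M)
    (Metric.ball_mem_nhds w hδ)
    (.of_forall fun w' => (integrable_mollify_integrand hη hs hF ε w').aestronglyMeasurable)
    (integrable_mollify_integrand hη hs hF ε w) ?_ ?_ (hηi.norm.mul_const M) ?_
  · exact h.2.differentiableAt
  · have h1 : Measurable fun u : ℂ => deriv F (w - ε • u) :=
      (measurable_deriv F).comp (by fun_prop)
    exact (hη.continuous.measurable.smul h1).aestronglyMeasurable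
  · refine .of_forall fun u w' hw' => ?_
    rw [norm_smul]
    by_cases hu : u ∈ Function.support η
    · exact mul_le_mul_of_nonneg_left (hM _ (hmem hu hw')) (norm_nonneg _)
    · simp [Function.notMem_support.1 hu]
  · refine .of_forall fun u w' hw' => ?_
    by_cases hu : u ∈ Function.support η
    · have h1 : HasDerivAt F (deriv F (w' - ε • u)) (w' - ε • u) :=
        ((hd _ (Metric.closedBall_subset_ball hδr (hmem hu hw'))).differentiableAt
          (Metric.isOpen_ball.mem_nhds
            (Metric.closedBall_subset_ball hδr (hmem hu hw')))).hasDerivAt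
      have h2 := h1.comp w' ((hasDerivAt_id w').sub_const (ε • u))
      rw [mul_one] at h2
      exact h2.const_smul (η u)
    · simp only [Function.notMem_support.1 hu, zero_smul]
      exact hasDerivAt_const _ _

/-! ### Cauchy's theorem and integral formula up to the boundary -/

/-- Tietze extension times a cutoff equal to `1` on `S`. Compact support provides uniform continuity
and makes Green's formula applicable to the mollifications. -/
lemma exists_continuous_hasCompactSupport_eqOn {S : Set ℂ} (hS : IsCompact S) {f : ℂ → ℂ}
    (hf : ContinuousOn f S) : ∃ F : ℂ → ℂ, Continuous F ∧ HasCompactSupport F ∧ EqOn F f S := by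
  obtain ⟨g, hg⟩ := ContinuousMap.exists_restrict_eq hS.isClosed ⟨S.domRestrict f, hf.domRestrict⟩
  obtain ⟨χ, hχ1, -, hχc, -⟩ :=
    exists_continuous_one_zero_of_isCompact hS isClosed_empty (disjoint_empty S)
  refine ⟨fun w => χ w • g w, χ.continuous.smul g.continuous, hχc.smul_right, fun w hw => ?_⟩
  have h1 : g w = f w := congrArg (fun h => h ⟨w, hw⟩) hg
  simp only [hχ1 hw, Pi.one_apply, one_smul, h1]

/-- Cauchy's theorem for a positively oriented system of rectifiable Jordan curves and a function
holomorphic inside and continuous up to the curves. -/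
theorem IsPositiveJordanSystem.integralOver_eq_zero {k : ℕ} {Γ : Fin k → RectifiableJordanCurve}
    (hΓ : IsPositiveJordanSystem Γ) {f : ℂ → ℂ} (hf : DifferentiableOn ℂ f (inside Γ))
    (hfc : ContinuousOn f (inside Γ ∪ traceOf Γ)) : integralOver Γ f = 0 := by
  obtain ⟨F, hF, hFc, hFf⟩ :=
    exists_continuous_hasCompactSupport_eqOn hΓ.isCompact_inside_union_traceOf hfc
  obtain ⟨η, hη, hs, hη0, hη1⟩ := exists_mollifier
  obtain ⟨L, hL0, hL⟩ := exists_norm_integralOver_le Γ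
  obtain ⟨C, hC0, hC⟩ := exists_volume_cthickening_traceOf_le Γ
  have hFd : DifferentiableOn ℂ F (inside Γ) := hf.congr fun w hw => hFf (Or.inl hw)
  rw [integralOver_congr Γ (hFf.symm.mono subset_union_right)]
  set M := ∫ u, ‖fderiv ℝ η u‖
  have hM : 0 ≤ M := integral_nonneg fun _ => norm_nonneg _
  have key (c : ℝ) (hc : 0 < c) : ‖integralOver Γ F‖ ≤ (2 * (M * C) + L) * c := by
    obtain ⟨δ, hδ, hδc⟩ := Metric.uniformContinuous_iff.1
      (hFc.uniformContinuous_of_continuous hF) c hc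
    set ε := min (δ / 2) 1
    have hε : 0 < ε := lt_min (by positivity) one_pos
    have hmod : ∀ v w, dist v w ≤ ε → ‖F v - F w‖ ≤ c := fun v w hvw => by
      rw [← dist_eq_norm]
      exact (hδc (hvw.trans_lt ((min_le_left _ _).trans_lt (by linarith)))).le
    have hG := contDiff_mollify hη hs hF hε
    have hsplit : integralOver Γ F = 2 * I * (∫ w in inside Γ, dbar (mollify η ε F) w) +
        integralOver Γ (fun t => F t - mollify η ε F t) := by
      rw [← hΓ.integralOver_eq_setIntegral_dbar hG (hasCompactSupport_mollify hs hε hFc),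
        integralOver_sub Γ hF.continuousOn hG.continuous.continuousOn]
      ring
    have harea := hC ε hε (min_le_right _ _)
    -- Away from the `ε`-neighbourhood of the curves, some ball of radius `r > ε` misses them, hence
    -- lies inside, and the mollification is holomorphic at its centre.
    have hsub : ∫ w in inside Γ, dbar (mollify η ε F) w =
        ∫ w in inside Γ ∩ Metric.cthickening ε (traceOf Γ), dbar (mollify η ε F) w := by
      refine (setIntegral_eq_of_subset_of_forall_sdiff_eq_zero hΓ.isOpen_inside.measurableSet
        inter_subset_left fun w hw => ?_)
      have hw2 : w ∉ Metric.cthickening ε (traceOf Γ) := fun h => hw.2 ⟨hw.1, h⟩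
      rw [Metric.cthickening_eq_iInter_thickening hε.le] at hw2
      simp only [mem_iInter, not_forall] at hw2
      obtain ⟨r, hr, hwr⟩ := hw2
      refine dbar_eq_zero (differentiableAt_mollify hη hs hF hε hr (hFd.mono ?_))
      refine hΓ.subset_inside (convex_ball w r).isPreconnected (fun t ht ht' => hwr ?_)
        (Metric.mem_ball_self (hε.trans hr)) hw.1
      rw [Metric.mem_thickening_iff]
      exact ⟨t, ht', by rwa [dist_comm, ← Metric.mem_ball]⟩
    have hvol : volume (inside Γ ∩ Metric.cthickening ε (traceOf Γ)) ≤ ENNReal.ofReal (C * ε) :=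
      (measure_mono inter_subset_right).trans harea
    have hvol' : volume.real (inside Γ ∩ Metric.cthickening ε (traceOf Γ)) ≤ C * ε :=
      ENNReal.toReal_le_of_le_ofReal (by positivity) hvol
    -- The growth `ε⁻¹` of the derivative is cancelled by the area `C * ε` of the strip, leaving
    -- only the oscillation `c`.
    have hI : ‖∫ w in inside Γ, dbar (mollify η ε F) w‖ ≤ M * C * c := by
      rw [hsub]
      calc _ ≤ ε⁻¹ * (c * M) * volume.real (inside Γ ∩ Metric.cthickening ε (traceOf Γ)) :=
            norm_setIntegral_le_of_norm_le_const (hvol.trans_lt ENNReal.ofReal_lt_top)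
              fun w _ => (norm_dbar_le _ w).trans (norm_fderiv_mollify_le hη hs hF hε hη1 hmod w)
        _ ≤ ε⁻¹ * (c * M) * (C * ε) := by gcongr
        _ = M * C * c := by field_simp
    have hJ := hL (fun t => F t - mollify η ε F t) c fun t _ =>
      norm_sub_mollify_le hη hs hF hε hη0 hη1 hmod t
    rw [hsplit]
    refine (norm_add_le _ _).trans ?_
    rw [norm_mul, norm_mul, norm_I, RCLike.norm_ofNat]
    linarith
  have hA : 0 ≤ 2 * (M * C) + L := by positivity
  refine norm_le_zero_iff.1 (le_of_forall_pos_le_add fun e he => ?_)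
  refine (key (e / (2 * (M * C) + L + 1)) (by positivity)).trans ?_
  rw [zero_add, mul_div_assoc', div_le_iff₀ (by positivity)]
  nlinarith

/-- Cauchy's integral formula for a positively oriented system of rectifiable Jordan curves. -/
theorem IsPositiveJordanSystem.integralOver_div_sub {k : ℕ} {Γ : Fin k → RectifiableJordanCurve}
    (hΓ : IsPositiveJordanSystem Γ) {f : ℂ → ℂ} (hf : DifferentiableOn ℂ f (inside Γ))
    (hfc : ContinuousOn f (inside Γ ∪ traceOf Γ)) {y : ℂ} (hy : y ∈ inside Γ) :
    integralOver Γ (fun t => f t / (t - y)) = 2 * Real.pi * I * f y := by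
  have hnhds : inside Γ ∈ 𝓝 y := hΓ.isOpen_inside.mem_nhds hy
  have hne : ∀ t ∈ traceOf Γ, t ≠ y := fun t ht h => hy.1 (h ▸ ht)
  -- The difference quotient extends holomorphically across `y`, so Cauchy's theorem applies to it;
  -- the remaining integral of `f y / (t - y)` is given by the winding number.
  have hd : DifferentiableOn ℂ (dslope f y) (inside Γ) :=
    (Complex.differentiableOn_dslope hnhds).2 hf
  have hc : ContinuousOn (dslope f y) (inside Γ ∪ traceOf Γ) :=
    (continuousOn_dslope (mem_of_superset hnhds subset_union_left)).2
      ⟨hfc, hf.differentiableAt hnhds⟩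
  have h0 := hΓ.integralOver_eq_zero hd hc
  have h1 : EqOn (dslope f y) (fun t => f t / (t - y) - f y * (t - y)⁻¹) (traceOf Γ) := by
    intro t ht
    rw [dslope_of_ne _ (hne t ht), slope_def_field]
    simp only [div_eq_mul_inv, sub_mul]
  have hci := continuousOn_inv_sub hy.1
  have h3 : ContinuousOn (fun t => f t / (t - y)) (traceOf Γ) :=
    (hfc.mono subset_union_right).div (by fun_prop) fun t ht => sub_ne_zero.2 (hne t ht)
  have h4 : ContinuousOn (fun t => f y * (t - y)⁻¹) (traceOf Γ) := continuousOn_const.mul hci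
  rw [integralOver_congr Γ h1, integralOver_sub Γ h3 h4, integralOver_const_mul,
    sub_eq_zero] at h0
  have h2 := hy.2
  rw [windingNumber, inv_mul_eq_iff_eq_mul₀ (by simp [Real.pi_ne_zero]), mul_one] at h2
  rw [h0, h2, mul_comm]

end

/-! ### Partial fractions, the barycentric formula and Hermite's error formula -/

section

open Polynomial

/-- Lagrange interpolation at `n + 1` nodes reproduces `p`; dividing its barycentric form by the
nodal polynomial leaves the partial fractions. -/
lemma eval_div_prod_sub_eq_sum {n : ℕ} {x : Fin (n + 1) → ℂ} (hx : Function.Injective x)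
    {p : ℂ[X]} (hp : p.natDegree ≤ n) {ζ : ℂ} (hζ : ∀ i, ζ ≠ x i) :
    p.eval ζ / ∏ i, (ζ - x i) =
      ∑ i, Lagrange.nodalWeight Finset.univ x i * p.eval (x i) * (ζ - x i)⁻¹ := by
  have hd : p.degree < (Finset.univ : Finset (Fin (n + 1))).card := by
    rw [Finset.card_univ, Fintype.card_fin]
    exact p.degree_le_natDegree.trans_lt (by exact_mod_cast Nat.lt_succ_of_le hp)
  have h := Lagrange.eval_interpolate_not_at_node (s := Finset.univ) (v := x)
    (fun i => p.eval (x i)) fun i _ => hζ i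
  rw [← Lagrange.eq_interpolate hx.injOn hd, Lagrange.eval_nodal] at h
  rw [h, mul_div_cancel_left₀ _ (Finset.prod_ne_zero_iff.2 fun i _ => sub_ne_zero.2 (hζ i))]
  exact Finset.sum_congr rfl fun i _ => by ring

variable {n m : ℕ}

/-- The denominator `∏ (X - z_j)` with the prescribed zeros. -/
noncomputable def polePoly (z : Fin m → ℂ) : ℂ[X] := ∏ j, (X - C (z j))

lemma natDegree_polePoly (z : Fin m → ℂ) : (polePoly z).natDegree = m := by
  simp [polePoly, natDegree_prod_of_monic _ _ fun j _ => monic_X_sub_C (z j)]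

lemma eval_polePoly (z : Fin m → ℂ) (ζ : ℂ) : (polePoly z).eval ζ = ∏ j, (ζ - z j) := by
  simp [polePoly, eval_prod]

lemma eval_polePoly_ne_zero {z : Fin m → ℂ} {ζ : ℂ} (h : ∀ j, ζ ≠ z j) :
    (polePoly z).eval ζ ≠ 0 := by
  rw [eval_polePoly]
  exact Finset.prod_ne_zero_iff.2 fun j _ => sub_ne_zero.2 (h j)

lemma baryWeight_eq (c : ℂ) (x : Fin (n + 1) → ℂ) (z : Fin m → ℂ) (i : Fin (n + 1)) :
    baryWeight c x z i = c * (Lagrange.nodalWeight Finset.univ x i * (polePoly z).eval (x i)) := by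
  rw [baryWeight, Lagrange.nodalWeight, Finset.prod_inv_distrib, eval_polePoly, div_eq_mul_inv]
  ring

/-- The numerator `p` interpolates `f` times the denominator at the nodes. The two barycentric sums
are then `c * p / ℓ` and `c * q / ℓ`, the latter because `m ≤ n`. -/
theorem isRationalInterpolant_baryRational (hmn : m ≤ n) {x : Fin (n + 1) → ℂ}
    (hx : Function.Injective x) (z : Fin m → ℂ) (f : ℂ → ℂ) {c : ℂ} (hc : c ≠ 0) :
    IsRationalInterpolant x z f (baryRational c x z f) := by
  set p : ℂ[X] := Lagrange.interpolate Finset.univ x fun i => f (x i) * (polePoly z).eval (x i)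
  have hpx (i) : p.eval (x i) = f (x i) * (polePoly z).eval (x i) :=
    Lagrange.eval_interpolate_at_node _ hx.injOn (Finset.mem_univ i)
  have hpd : p.natDegree ≤ n := by
    have h : p.degree < (Finset.univ : Finset (Fin (n + 1))).card :=
      Lagrange.degree_interpolate_lt _ hx.injOn
    rw [Finset.card_univ, Fintype.card_fin] at h
    exact natDegree_le_of_degree_le (Order.le_of_lt_succ (by exact_mod_cast h))
  refine ⟨⟨p, hpd, fun ζ hζ => ?_⟩, fun i => by rw [baryRational, if_pos ⟨i, rfl⟩]⟩
  rw [← eval_polePoly]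
  by_cases h : ∃ i, ζ = x i
  · obtain ⟨i, rfl⟩ := h
    rw [baryRational, if_pos ⟨i, rfl⟩, hpx, mul_div_cancel_right₀ _ (eval_polePoly_ne_zero hζ)]
  · rw [baryRational, if_neg h]
    rw [not_exists] at h
    have hl : ∏ i, (ζ - x i) ≠ 0 := Finset.prod_ne_zero_iff.2 fun i _ => sub_ne_zero.2 (h i)
    have h1 : ∑ i, baryWeight c x z i * f (x i) / (ζ - x i) =
        c * (p.eval ζ / ∏ i, (ζ - x i)) := by
      rw [eval_div_prod_sub_eq_sum hx hpd h, Finset.mul_sum]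
      exact Finset.sum_congr rfl fun i _ => by rw [baryWeight_eq, hpx]; ring
    have h2 : ∑ i, baryWeight c x z i / (ζ - x i) =
        c * ((polePoly z).eval ζ / ∏ i, (ζ - x i)) := by
      rw [eval_div_prod_sub_eq_sum hx ((natDegree_polePoly z).le.trans hmn) h, Finset.mul_sum]
      exact Finset.sum_congr rfl fun i _ => by rw [baryWeight_eq]; ring
    rw [h1, h2, mul_div_mul_left _ _ hc, div_div_div_cancel_right₀ hl]

/-- Hermite's error formula for rational interpolants with prescribed poles. -/
theorem IsRationalInterpolant.sub_eq_integralOver (hmn : m ≤ n) {k : ℕ}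
    {Γ : Fin k → RectifiableJordanCurve} (hΓ : IsPositiveJordanSystem Γ) {f : ℂ → ℂ}
    (hf : DifferentiableOn ℂ f (inside Γ)) (hfc : ContinuousOn f (inside Γ ∪ traceOf Γ))
    {x : Fin (n + 1) → ℂ} (hx : Function.Injective x) (hxΓ : ∀ i, x i ∈ inside Γ)
    {z : Fin m → ℂ} (hxz : ∀ i j, x i ≠ z j) {r : ℂ → ℂ} (hr : IsRationalInterpolant x z f r)
    {ξ : ℂ} (hξ : ξ ∈ inside Γ) (hξz : ∀ j, ξ ≠ z j) :
    f ξ - r ξ = (2 * Real.pi * Complex.I)⁻¹ *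
      integralOver Γ (fun t => phi x z ξ / phi x z t * (f t / (t - ξ))) := by
  have hpi : (2 * Real.pi * Complex.I : ℂ) ≠ 0 := by simp [Real.pi_ne_zero]
  -- At a node both sides vanish: `phi x z ξ = 0` on the right, interpolation on the left.
  by_cases hξx : ∃ i, ξ = x i
  · obtain ⟨i, rfl⟩ := hξx
    have h0 : phi x z (x i) = 0 := by
      rw [phi, Finset.prod_eq_zero (Finset.mem_univ i) (sub_self _), zero_div]
    have h1 := integralOver_const_mul Γ 0 fun _ => 0
    rw [zero_mul] at h1
    simp only [h0, zero_div, zero_mul] at h1 ⊢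
    rw [h1, hr.interpolates i, sub_self, mul_zero]
  rw [not_exists] at hξx
  obtain ⟨p, hpd, hp⟩ := hr.rational
  set q := polePoly z
  have hqd : q.natDegree ≤ n := (natDegree_polePoly z).le.trans hmn
  have hqξ : q.eval ξ ≠ 0 := eval_polePoly_ne_zero hξz
  have hlξ : ∏ i, (ξ - x i) ≠ 0 := Finset.prod_ne_zero_iff.2 fun i _ => sub_ne_zero.2 (hξx i)
  have hpx (i) : p.eval (x i) = q.eval (x i) * f (x i) := by
    rw [← hr.interpolates i, hp _ (hxz i), ← eval_polePoly,
      mul_div_cancel₀ _ (eval_polePoly_ne_zero (hxz i))]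
  set w : Fin (n + 1) → ℂ := fun i =>
    Lagrange.nodalWeight Finset.univ x i * q.eval (x i) * (ξ - x i)⁻¹
  have hcont {y : ℂ} (hy : y ∈ inside Γ) : ContinuousOn (fun t => f t / (t - y)) (traceOf Γ) :=
    (hfc.mono Set.subset_union_right).div (by fun_prop)
      fun t ht => sub_ne_zero.2 fun h => hy.1 (h ▸ ht)
  have hcongr : Set.EqOn (fun t => phi x z ξ / phi x z t * (f t / (t - ξ)))
      (fun t => phi x z ξ * ∑ i, w i * (f t / (t - ξ) - f t / (t - x i))) (traceOf Γ) := by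
    intro t ht
    have htξ : t - ξ ≠ 0 := sub_ne_zero.2 fun h => hξ.1 (h ▸ ht)
    have htx (i) : t ≠ x i := fun h => (hxΓ i).1 (h ▸ ht)
    -- This holds also when `t` is some `z j` on the curve: division by zero gives `0` on the left,
    -- and `q.eval t = 0` on the right.
    have h1 : phi x z ξ / phi x z t = phi x z ξ * (q.eval t / ∏ i, (t - x i)) := by
      rw [div_eq_mul_inv, phi.eq_def x z t, inv_div, eval_polePoly]
    simp only [h1, mul_assoc]
    rw [eval_div_prod_sub_eq_sum hx hqd htx, Finset.sum_mul]
    congr 1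
    refine Finset.sum_congr rfl fun i _ => ?_
    have h2 : t - x i ≠ 0 := sub_ne_zero.2 (htx i)
    have h3 : ξ - x i ≠ 0 := sub_ne_zero.2 (hξx i)
    simp only [w]
    field_simp
    ring
  have hterm (i) : integralOver Γ (fun t => w i * (f t / (t - ξ) - f t / (t - x i))) =
      2 * Real.pi * Complex.I * (w i * (f ξ - f (x i))) := by
    rw [integralOver_const_mul, integralOver_sub Γ (hcont hξ) (hcont (hxΓ i)),
      hΓ.integralOver_div_sub hf hfc hξ, hΓ.integralOver_div_sub hf hfc (hxΓ i)]
    ring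
  -- Read backwards at `ξ`, the partial fractions of `q / ℓ` and `p / ℓ` collect the Cauchy values
  -- into `(q f - p) / ℓ`.
  have h1 : ∑ i, w i * f ξ = q.eval ξ / (∏ i, (ξ - x i)) * f ξ := by
    rw [eval_div_prod_sub_eq_sum hx hqd hξx, Finset.sum_mul]
  have h2 : ∑ i, w i * f (x i) = p.eval ξ / ∏ i, (ξ - x i) := by
    rw [eval_div_prod_sub_eq_sum hx hpd hξx]
    exact Finset.sum_congr rfl fun i _ => by simp only [w, hpx]; ring
  have hcont' (i) :
      ContinuousOn (fun t => w i * (f t / (t - ξ) - f t / (t - x i))) (traceOf Γ) :=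
    continuousOn_const.mul ((hcont hξ).sub (hcont (hxΓ i)))
  rw [integralOver_congr Γ hcongr, integralOver_const_mul,
    integralOver_finset_sum Γ _ fun i _ => hcont' i]
  rw [Finset.sum_congr rfl fun i _ => hterm i, ← Finset.mul_sum]
  simp only [mul_sub (w _), Finset.sum_sub_distrib]
  rw [h1, h2, hp ξ hξz, phi, ← eval_polePoly]
  change f ξ - p.eval ξ / q.eval ξ = _ * ((∏ i, (ξ - x i)) / q.eval ξ * _)
  field_simp

end

end HermiteRational

theorem mainTheorem2 {k n m : ℕ} (hmn : m ≤ n)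
    (E : Set ℂ) (hE : IsCompact E)
    (Γ : Fin k → HermiteRational.RectifiableJordanCurve)
    (hΓ : HermiteRational.IsPositiveJordanSystem Γ)
    (hEΓ : E ⊆ HermiteRational.inside Γ)
    (f : ℂ → ℂ)
    (hf : AnalyticOnNhd ℂ f (HermiteRational.inside Γ))
    (hfc : ContinuousOn f (HermiteRational.inside Γ ∪ HermiteRational.traceOf Γ))
    (x : Fin (n + 1) → ℂ) (hx : Function.Injective x)
    (hxΓ : ∀ i, x i ∈ HermiteRational.inside Γ)
    (z : Fin m → ℂ) (hz : Function.Injective z) (hxz : ∀ i j, x i ≠ z j) :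
    (∀ C : ℂ, C ≠ 0 →
      HermiteRational.IsRationalInterpolant x z f (HermiteRational.baryRational C x z f)) ∧
    ∀ r : ℂ → ℂ, HermiteRational.IsRationalInterpolant x z f r →
      ∀ ξ ∈ E, (∀ j, ξ ≠ z j) →
        f ξ - r ξ = (2 * Real.pi * Complex.I)⁻¹ *
          HermiteRational.integralOver Γ (fun t =>
            HermiteRational.phi x z ξ / HermiteRational.phi x z t * (f t / (t - ξ))) :=
  ⟨fun _ hC => HermiteRational.isRationalInterpolant_baryRational hmn hx z f hC,
    fun _ hr _ hξ hξz => hr.sub_eq_integralOver hmn hΓ hf.differentiableOn hfc hx hxΓ hxz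
      (hEΓ hξ) hξz⟩
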